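/- Let $d\in\mathbb N$, $T>0$, let $q\in C^\infty(\mathbb R^d)$ be non-negative and let $u_0\in H^1(\mathbb R^d)$ (complex valued). Let $\omega(\varepsilon)>0$ for $\varepsilon\in(0,1]$, with $\omega(\varepsilon)\to0$ as $\varepsilon\to0$. Let $\mathbb A_\infty$ be the set of real-valued Schwartz functions $\psi$ on $\mathbb R^d$ with $\int\psi=1$ and $\int x^\alpha\psi(x)\,dx=0$ for every multi-index $\alpha\neq0$. For $\psi\in\mathbb A_\infty$ put $\psi_\varepsilon(x)=\omega(\varepsilon)^{-d}\psi(x/\omega(\varepsilon))$, $q_\varepsilon=q*\psi_\varepsilon$ and $u_{0,\varepsilon}=u_0*\psi_\varepsilon$, and for a second $\tilde\psi\in\mathbb A_\infty$ define $\tilde q_\varepsilon,\tilde u_{0,\varepsilon}$ in the same way. Let $u_\varepsilon,\tilde u_\varepsilon\in C^1([0,T];L^2)\cap C([0,T];H^1)$ solve, for every $\varepsilon\in(0,1]$, $$\partial_tu_\varepsilon-\Delta u_\varepsilon+q_\varepsilon u_\varepsilon=0,\quad u_\varepsilon(0,\cdot)=u_{0,\varepsilon},\qquad\qquad \partial_t\tilde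 u_\varepsilon-\Delta\tilde u_\varepsilon+\tilde q_\varepsilon\tilde u_\varepsilon=0,\quad \tilde u_\varepsilon(0,\cdot)=\tilde u_{0,\varepsilon}$$ on $(0,T)\times\mathbb R^d$. Assume that the regularised data are moderate, i.e. $\|u_{0,\varepsilon}\|_{H^1}\le C\omega(\varepsilon)^{-N_0}$ for some $C,N_0$ and all $\varepsilon\in(0,1]$, and likewise for $\tilde u_{0,\varepsilon}$, and that they differ by an $\mathbb A_\infty$-negligible net: for every integer $k\ge1$ there is $C_k$ with $\|u_{0,\varepsilon}-\tilde u_{0,\varepsilon}\|_{L^2}\le C_k\,\omega(\varepsilon)^k$ for all $\varepsilon\in(0,1]$. Then the very weak solution is unique, in the following sense: for every integer $N\ge1$ there is $C_N$ such that $$\|u_\varepsilon(t,\cdot)-\tilde u_\varepsilon(t,\cdot)\|_{L^2}\le C_N\,\omega(\varepsilon)^N\qquad\text{for all }\varepsilon\in(0,1],\ t\in[0,T],$$ in each of the following two cases: (i) $q_\varepsilon,\tilde q_\varepsilon$ are well defined, non-negative and moderate ($\|q_\varepsilon\|_{L^\infty}\le C\omega(\varepsilon)^{-N}$ for some $C,N$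 and all $\varepsilon\in(0,1]$, and likewise for $\tilde q_\varepsilon$), and the regularised coefficients also differ by an $\mathbb A_\infty$-negligible net, i.e. for every integer $k\ge1$ there is $C_k$ with $\|q_\varepsilon-\tilde q_\varepsilon\|_{L^\infty}\le C_k\,\omega(\varepsilon)^k$ for all $\varepsilon\in(0,1]$; (ii) $q$ and all its derivatives are bounded on $\mathbb R^d$ (nothing further being required of $q_\varepsilon,\tilde q_\varepsilon$). -/

import Mathlib

open MeasureTheory Set Filter Topology
open scoped SchwartzMap LineDeriv Laplacian ENNReal

noncomputable section

/-- The Euclidean space `ℝᵈ`. -/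
abbrev Space (d : ℕ) : Type := EuclideanSpace ℝ (Fin d)

/-- Complex-valued `L²(ℝᵈ)`. -/
abbrev L2 (d : ℕ) : Type := Lp ℂ 2 (volume : Measure (Space d))

/-- The Sobolev space `H¹(ℝᵈ)`, as the space of pairs `(f, (∂₁f, …, ∂_d f))` of an `L²` function and
its distributional partial derivatives, all of them in `L²`. It carries the norm
`(‖f‖² + ∑ᵢ ‖∂ᵢf‖²) ^ (1/2)`, inherited from the surrounding product. -/
def H1 (d : ℕ) : Submodule ℂ (WithLp 2 (L2 d × PiLp 2 (fun _ : Fin d => L2 d))) where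
  carrier := {p | ∀ i : Fin d,
    ∂_{(EuclideanSpace.single i (1 : ℝ) : Space d)} (p.fst : 𝓢'(Space d, ℂ))
      = ((p.snd i : L2 d) : 𝓢'(Space d, ℂ))}
  add_mem' := by
    intro a b ha hb i
    have h1 := ha i
    have h2 := hb i
    simp only [← Lp.toTemperedDistributionCLM_apply] at h1 h2 ⊢
    simp only [WithLp.add_fst, WithLp.add_snd, PiLp.add_apply, map_add, LineDeriv.lineDerivOp_add, h1, h2]
  zero_mem' := by
    intro i
    simp only [← Lp.toTemperedDistributionCLM_apply]
    simp only [WithLp.zero_fst, WithLp.zero_snd, PiLp.zero_apply, map_zero, LineDeriv.lineDerivOp_zero]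
  smul_mem' := by
    intro c a ha i
    have h1 := ha i
    simp only [← Lp.toTemperedDistributionCLM_apply] at h1 ⊢
    simp only [WithLp.smul_fst, WithLp.smul_snd, PiLp.smul_apply, map_smul, LineDeriv.lineDerivOp_smul, h1]

/-- The inclusion `H¹(ℝᵈ) ⊆ L²(ℝᵈ)`. -/
def toL2 {d : ℕ} (v : H1 d) : L2 d := (v : WithLp 2 (L2 d × PiLp 2 (fun _ : Fin d => L2 d))).fst

/-- The mollifiers with vanishing moments up to order `n`: real-valued Schwartz functions `ψ` with
`∫ ψ = 1` and `∫ x^α ψ(x) dx = 0` for all multi-indices `α` with `1 ≤ |α| ≤ n`. -/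
def mollifierClass (d n : ℕ) : Set 𝓢(Space d, ℝ) :=
  {ψ | ∫ x, ψ x = 1 ∧
    ∀ α : Fin d → ℕ, 1 ≤ ∑ i, α i → ∑ i, α i ≤ n → ∫ x : Space d, (∏ i, x i ^ α i) * ψ x = 0}

/-- `𝔸_∞`: all moments of positive order vanish. -/
def mollifierClassInf (d : ℕ) : Set 𝓢(Space d, ℝ) := {ψ | ∀ n : ℕ, ψ ∈ mollifierClass d n}

/-- The rescaled mollifier `x ↦ δ⁻ᵈ ψ(x / δ)`. -/
def rescale {d : ℕ} (ψ : 𝓢(Space d, ℝ)) (δ : ℝ) : Space d → ℝ :=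
  fun x => (δ ^ d)⁻¹ * ψ (δ⁻¹ • x)

/-- The regularisation `f ∗ ψ_δ`, with `ψ_δ(x) = δ⁻ᵈ ψ(x / δ)`. -/
def regularise {d : ℕ} {F : Type*} [NormedAddCommGroup F] [NormedSpace ℝ F]
    (ψ : 𝓢(Space d, ℝ)) (δ : ℝ) (f : Space d → F) : Space d → F :=
  convolution (rescale ψ δ) f (ContinuousLinearMap.lsmul ℝ ℝ) volume

/-- `H¹`-moderateness of the regularised data: `u₀ ∗ ψ_ε` is in `H¹` with
`‖u₀ ∗ ψ_ε‖_{H¹} ≤ C ω(ε)⁻ᴺ` for all `ε ∈ (0, 1]`, for some `N` and `C`. -/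
def DataModerate {d : ℕ} (ω : ℝ → ℝ) (u₀ : H1 d) (ψ : 𝓢(Space d, ℝ)) : Prop :=
  ∃ N : ℕ, ∃ C : ℝ, 0 < C ∧ ∀ ε ∈ Ioc (0 : ℝ) 1, ∃ v : H1 d,
    toL2 v =ᵐ[volume] regularise ψ (ω ε) (toL2 u₀) ∧ ‖v‖ ≤ C * (ω ε ^ N)⁻¹

/-- `L^∞`-moderateness of the regularised coefficient: `q ∗ ψ_ε` is well defined and
`‖q ∗ ψ_ε‖_{L^∞} ≤ C ω(ε)⁻ᴺ` for all `ε ∈ (0, 1]`, for some `N` and `C`. -/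
def CoeffModerate {d : ℕ} (ω : ℝ → ℝ) (q : Space d → ℝ) (ψ : 𝓢(Space d, ℝ)) : Prop :=
  ∃ N : ℕ, ∃ C : ℝ, 0 < C ∧ ∀ ε ∈ Ioc (0 : ℝ) 1,
    ConvolutionExists (rescale ψ (ω ε)) q (ContinuousLinearMap.lsmul ℝ ℝ) volume ∧
    eLpNorm (regularise ψ (ω ε) q) ∞ volume ≤ ENNReal.ofReal (C * (ω ε ^ N)⁻¹)

/-- The regularised coefficients `q ∗ ψ_ε`, `ε ∈ (0, 1]`, are non-negative functions. -/
def CoeffNonneg {d : ℕ} (ω : ℝ → ℝ) (q : Space d → ℝ) (ψ : 𝓢(Space d, ℝ)) : Prop :=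
  ∀ ε ∈ Ioc (0 : ℝ) 1, ∀ x, 0 ≤ regularise ψ (ω ε) q x

/-- `‖u₀ ∗ ψ_ε - u₀ ∗ ψ'_ε‖_{L²} ≤ C_k ω(ε)ᵏ` for all `k > 0`. -/
def DataNegligible {d : ℕ} (ω : ℝ → ℝ) (u₀ : H1 d) (ψ ψ' : 𝓢(Space d, ℝ)) : Prop :=
  ∀ k : ℕ, 0 < k → ∃ C : ℝ, 0 < C ∧ ∀ ε ∈ Ioc (0 : ℝ) 1,
    eLpNorm (regularise ψ (ω ε) (toL2 u₀) - regularise ψ' (ω ε) (toL2 u₀)) 2 volume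
      ≤ ENNReal.ofReal (C * ω ε ^ k)

/-- `‖q ∗ ψ_ε - q ∗ ψ'_ε‖_{L^∞} ≤ C_k ω(ε)ᵏ` for all `k > 0`. -/
def CoeffNegligible {d : ℕ} (ω : ℝ → ℝ) (q : Space d → ℝ) (ψ ψ' : 𝓢(Space d, ℝ)) : Prop :=
  ∀ k : ℕ, 0 < k → ∃ C : ℝ, 0 < C ∧ ∀ ε ∈ Ioc (0 : ℝ) 1,
    eLpNorm (regularise ψ (ω ε) q - regularise ψ' (ω ε) q) ∞ volume
      ≤ ENNReal.ofReal (C * ω ε ^ k)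

/-- `u ∈ C¹([0, T]; L²) ∩ C([0, T]; H¹)` solves `∂ₜu - Δu + p u = 0` on `(0, T) × ℝᵈ` with
`u(0, ·) = f`. Here `w` is the distributional Laplacian of `u(t, ·)`, and the equation is an
equality in `L²` for every `t ∈ (0, T)`. -/
structure SolvesHeat {d : ℕ} (T : ℝ) (p : Space d → ℝ) (f : Space d → ℂ) (u : ℝ → H1 d) :
    Prop where
  continuousOn : ContinuousOn u (Icc 0 T)
  contDiffOn : ContDiffOn ℝ 1 (fun t => toL2 (u t)) (Icc 0 T)
  equation : ∀ t ∈ Ioo 0 T, ∃ w : L2 d,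
    Δ (toL2 (u t) : 𝓢'(Space d, ℂ)) = (w : 𝓢'(Space d, ℂ)) ∧
    ∀ᵐ x : Space d, (deriv (fun s => toL2 (u s)) t : L2 d) x - w x + (p x : ℂ) * toL2 (u t) x = 0
  initial : toL2 (u 0) =ᵐ[volume] f

/-- For every `ε ∈ (0, 1]`, `u ε` solves the heat equation with the regularised coefficient
`q ∗ ψ_ε` and the regularised data `u₀ ∗ ψ_ε`. -/
def SolvesRegularised {d : ℕ} (T : ℝ) (ω : ℝ → ℝ) (q : Space d → ℝ) (u₀ : H1 d)
    (ψ : 𝓢(Space d, ℝ)) (u : ℝ → ℝ → H1 d) : Prop :=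
  ∀ ε ∈ Ioc (0 : ℝ) 1,
    SolvesHeat T (regularise ψ (ω ε) q) (regularise ψ (ω ε) (toL2 u₀)) (u ε)

/-- `‖u_ε(t, ·) - u'_ε(t, ·)‖_{L²} ≤ C_N ω(ε)ᴺ` for all `N ≥ 1`, uniformly in `t ∈ [0, T]` and
`ε ∈ (0, 1]`. -/
def NetsAgree {d : ℕ} (T : ℝ) (ω : ℝ → ℝ) (u u' : ℝ → ℝ → H1 d) : Prop :=
  ∀ N : ℕ, 0 < N → ∃ C : ℝ, 0 < C ∧ ∀ ε ∈ Ioc (0 : ℝ) 1, ∀ t ∈ Icc 0 T,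
    ‖toL2 (u ε t) - toL2 (u' ε t)‖ ≤ C * ω ε ^ N

/-- Uniqueness of the very weak solution for `(q, u₀)`: whenever `ψ, ψ' ∈ 𝔸_∞` give moderate
regularisations with non-negative coefficients, and the regularised data and coefficients
differ by negligible nets, the corresponding solution nets differ by a negligible net. -/
def VeryWeakSolutionUnique {d : ℕ} (T : ℝ) (ω : ℝ → ℝ) (q : Space d → ℝ) (u₀ : H1 d) : Prop :=
  ∀ ψ ∈ mollifierClassInf d, ∀ ψ' ∈ mollifierClassInf d,
    DataModerate ω u₀ ψ → DataModerate ω u₀ ψ' →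
    CoeffModerate ω q ψ → CoeffModerate ω q ψ' →
    CoeffNonneg ω q ψ → CoeffNonneg ω q ψ' →
    DataNegligible ω u₀ ψ ψ' → CoeffNegligible ω q ψ ψ' →
    ∀ u u' : ℝ → ℝ → H1 d,
      SolvesRegularised T ω q u₀ ψ u → SolvesRegularised T ω q u₀ ψ' u' → NetsAgree T ω u u'

/-- The stronger form in which only the regularised data are required to differ by a negligible
net, and nothing is required of the regularised coefficients. -/
def VeryWeakSolutionUniqueOfData {d : ℕ} (T : ℝ) (ω : ℝ → ℝ) (q : Space d → ℝ) (u₀ : H1 d) :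
    Prop :=
  ∀ ψ ∈ mollifierClassInf d, ∀ ψ' ∈ mollifierClassInf d,
    DataModerate ω u₀ ψ → DataModerate ω u₀ ψ' → DataNegligible ω u₀ ψ ψ' →
    ∀ u u' : ℝ → ℝ → H1 d,
      SolvesRegularised T ω q u₀ ψ u → SolvesRegularised T ω q u₀ ψ' u' → NetsAgree T ω u u'

end

/-! The proof is an energy estimate with constants uniform in `ε`. The difference `z = u - u'`
solves the heat equation with potential `p` and source `-(p - p') u'`. Pairing with `z` in L², the
Laplacian contributes a nonpositive term, a potential bounded below by `-M` at most `M ‖z‖ ^ 2`, and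
Young's inequality handles the source. Grönwall's argument then bounds `z` by the difference of the
data and by `‖p - p'‖_∞` times the size of `u'` (`SolvesHeat.norm_sub_sq_le`). The same estimate
without source bounds `u'` by its moderate initial data, and this loss `ω ^ (-N₀)` is absorbed by
negligibility of the coefficients at order `N + N₀`.

In case (i), `M = 0`. In case (ii) the mollifiers may change sign, so the regularised coefficients
need not be nonnegative, but Young's convolution bound gives a lower bound independent of `ε`. Their
difference is negligible because the vanishing moments annihilate every nonconstant Taylor term of
`q`, which makes each regularisation close to `q` to every order (`exists_abs_regularise_sub_le`).
-/

/-! ### Dissipativity and the energy inequality -/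

theorem re_inner_ofReal_mul_self (c : ℝ) (a : ℂ) :
    (inner ℂ a ((c : ℂ) * a)).re = c * ‖a‖ ^ 2 := by
  rw [RCLike.inner_apply, mul_assoc, Complex.mul_conj, Complex.normSq_eq_norm_sq,
    ← Complex.ofReal_mul, Complex.ofReal_re]

open scoped FourierTransform in
/-- The Laplacian on `L²(ℝᵈ)` is dissipative. -/
theorem re_inner_laplacian_nonpos {d : ℕ} (z w : L2 d)
    (h : Δ (z : 𝓢'(Space d, ℂ)) = (w : 𝓢'(Space d, ℂ))) : (inner ℂ z w).re ≤ 0 := by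
  -- On the Fourier side the Laplacian is multiplication by `-(2π)² ‖x‖²`. This identity of
  -- distributions becomes an a.e. identity by testing on smooth compactly supported functions, and
  -- Plancherel then shows the sign.
  have hF : ((𝓕 w : L2 d) : 𝓢'(Space d, ℂ))
      = ((-(2 * Real.pi) ^ 2 : ℝ) : ℂ) •
      TemperedDistribution.smulLeftCLM ℂ (fun x : Space d => Complex.ofReal (‖x‖ ^ 2))
        ((𝓕 z : L2 d) : 𝓢'(Space d, ℂ)) := by
    rw [← Lp.fourier_toTemperedDistribution_eq, ← h,
      TemperedDistribution.laplacian_eq_fourierMultiplierCLM,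
      TemperedDistribution.fourierMultiplierCLM_apply, ← Lp.fourier_toTemperedDistribution_eq,
      ← Complex.coe_smul, FourierTransform.fourier_smul,
      FourierTransform.fourier_fourierInv_eq]
  have htg : (fun x : Space d => Complex.ofReal (‖x‖ ^ 2)).HasTemperateGrowth := by fun_prop
  have hli : ∀ f : L2 d, LocallyIntegrable f volume := fun f =>
    (Lp.memLp f).locallyIntegrable (by norm_num)
  have hae : ∀ᵐ x : Space d, (𝓕 w : L2 d) x
      = (-(2 * Real.pi) ^ 2 * ‖x‖ ^ 2 : ℝ) • (𝓕 z : L2 d) x := by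
    refine ae_eq_of_integral_contDiff_smul_eq (hli _) ?_ fun g g_smooth g_cpt => ?_
    · rw [← locallyIntegrableOn_univ]
      exact (hli _).locallyIntegrableOn _ |>.continuousOn_smul
        isOpen_univ.isLocallyClosed (by fun_prop)
    · have hg₁ : HasCompactSupport (Complex.ofRealCLM ∘ g) := g_cpt.comp_left rfl
      have hg₂ : ContDiff ℝ (⊤ : ℕ∞) (Complex.ofRealCLM ∘ g) := by fun_prop
      have := congrArg (fun D : 𝓢'(Space d, ℂ) => D (hg₁.toSchwartzMap hg₂)) hF
      simp only [Lp.toTemperedDistribution_apply] at this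
      have h2 : ∀ (c : ℂ) (D : 𝓢'(Space d, ℂ)) (φ : 𝓢(Space d, ℂ)), (c • D) φ = c • D φ :=
        fun _ _ _ => rfl
      rw [h2, TemperedDistribution.smulLeftCLM_apply_apply, Lp.toTemperedDistribution_apply,
        ← integral_smul] at this
      refine Eq.trans (Eq.trans ?_ this) ?_
      · rfl
      · congr 1
        ext x
        rw [SchwartzMap.smulLeftCLM_apply_apply htg]
        simp
        ring
  rw [← Lp.inner_fourier_eq, L2.inner_def, ← RCLike.re_eq_complex_re, ← integral_re]
  · refine integral_nonpos_of_ae ?_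
    filter_upwards [hae] with x hx
    rw [hx, ← Complex.coe_smul, smul_eq_mul, RCLike.re_eq_complex_re, re_inner_ofReal_mul_self]
    have : (0 : ℝ) ≤ (2 * Real.pi) ^ 2 * ‖x‖ ^ 2 * ‖(𝓕 z : L2 d) x‖ ^ 2 := by positivity
    simp only [Pi.zero_apply]
    linarith
  · exact L2.integrable_inner _ _

/-- In the factor `2 * M + 1`, `2 * M` comes from the potential and `1` from Young's inequality `2
‖z‖ η ‖v‖ ≤ ‖z‖ ^ 2 + η ^ 2 ‖v‖ ^ 2`, applied pointwise. -/
theorem two_mul_re_inner_le {d : ℕ} {z z' w v : L2 d}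
    (h : Δ (z : 𝓢'(Space d, ℂ)) = (w : 𝓢'(Space d, ℂ))) {p : Space d → ℝ} {M η : ℝ}
    (hp : ∀ x, -M ≤ p x) {g : Space d → ℂ} (hg : ∀ᵐ x, ‖g x‖ ≤ η * ‖v x‖)
    (heq : ∀ᵐ x, z' x - w x + (p x : ℂ) * z x = g x) :
    2 * (inner ℂ z z').re ≤ (2 * M + 1) * ‖z‖ ^ 2 + η ^ 2 * ‖v‖ ^ 2 := by
  have key : ∀ f : L2 d, Integrable (fun x => ‖f x‖ ^ 2) ∧ ‖f‖ ^ 2 = ∫ x, ‖f x‖ ^ 2 := by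
    intro f
    refine ⟨(memLp_two_iff_integrable_sq_norm (Lp.aestronglyMeasurable f)).1 (Lp.memLp f), ?_⟩
    have h1 : ‖f‖ ^ 2 = (inner ℂ f f).re := by
      rw [inner_self_eq_norm_sq_to_K]; norm_cast
    rw [h1, L2.inner_def, ← RCLike.re_eq_complex_re, ← integral_re (L2.integrable_inner _ _)]
    simp [inner_self_eq_norm_sq_to_K]
    norm_cast
  have h1 : (inner ℂ z z').re = (inner ℂ z w).re + (inner ℂ z (z' - w)).re := by
    rw [inner_sub_right]; simp
  have h2 := re_inner_laplacian_nonpos z w h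
  have h3 : 2 * (inner ℂ z (z' - w)).re ≤ ∫ x, (2 * M + 1) * ‖z x‖ ^ 2 + η ^ 2 * ‖v x‖ ^ 2 := by
    rw [L2.inner_def, ← RCLike.re_eq_complex_re, ← integral_re (L2.integrable_inner _ _),
      ← integral_const_mul]
    refine integral_mono_ae ((L2.integrable_inner _ _).re.const_mul 2)
      (((key z).1.const_mul _).add ((key v).1.const_mul _)) ?_
    filter_upwards [hg, heq, Lp.coeFn_sub z' w] with x hx1 hx2 hx3
    have e : (z' - w : L2 d) x = g x - (p x : ℂ) * z x := by
      rw [hx3, Pi.sub_apply, ← hx2]; ring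
    have e3 : (inner ℂ (z x) (g x)).re ≤ ‖z x‖ * (η * ‖v x‖) :=
      ((Complex.re_le_norm _).trans (norm_inner_le_norm _ _)).trans (by gcongr)
    simp only [RCLike.re_eq_complex_re]
    rw [e, inner_sub_right, Complex.sub_re, re_inner_ofReal_mul_self]
    nlinarith [mul_le_mul_of_nonneg_right (hp x) (sq_nonneg ‖z x‖), sq_nonneg (‖z x‖ - η * ‖v x‖)]
  rw [integral_add ((key z).1.const_mul _) ((key v).1.const_mul _), integral_const_mul,
    integral_const_mul, ← (key z).2, ← (key v).2] at h3
  linarith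

theorem norm_sq_le_of_energy {d : ℕ} {z : ℝ → L2 d} {T K b : ℝ} (hK : 0 ≤ K) (hb : 0 ≤ b)
    (hc : ContinuousOn z (Icc 0 T)) (hd : ∀ t ∈ Ioo 0 T, DifferentiableAt ℝ z t)
    (h : ∀ t ∈ Ioo 0 T, 2 * (inner ℂ (z t) (deriv z t)).re ≤ K * ‖z t‖ ^ 2 + b)
    {t : ℝ} (ht : t ∈ Icc 0 T) : ‖z t‖ ^ 2 ≤ Real.exp (K * T) * (‖z 0‖ ^ 2 + T * b) := by
  have hsq : ∀ f : L2 d, ‖f‖ ^ 2 = (inner ℂ f f).re := fun f => by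
    rw [inner_self_eq_norm_sq_to_K]; norm_cast
  -- Integrating factor for Grönwall: since `exp (-K t) ≤ 1` and `0 ≤ b`, subtracting `b * s`
  -- suffices to make this function antitone.
  have hder : ∀ t ∈ Ioo 0 T, HasDerivAt (fun s => Real.exp (-K * s) * ‖z s‖ ^ 2 - b * s)
      (Real.exp (-K * t) * (2 * (inner ℂ (z t) (deriv z t)).re - K * ‖z t‖ ^ 2) - b) t := by
    intro t ht
    have h1 := (hd t ht).hasDerivAt
    have h2 : HasDerivAt (fun s => ‖z s‖ ^ 2) (2 * (inner ℂ (z t) (deriv z t)).re) t := by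
      have h3 := Complex.reCLM.hasFDerivAt.comp_hasDerivAt t (h1.inner ℂ h1)
      have h4 : Complex.reCLM (inner ℂ (z t) (deriv z t) + inner ℂ (deriv z t) (z t))
          = 2 * (inner ℂ (z t) (deriv z t)).re := by
        have := inner_re_symm (𝕜 := ℂ) (deriv z t) (z t)
        simp only [RCLike.re_eq_complex_re] at this
        rw [Complex.reCLM_apply, Complex.add_re, this]
        ring
      rw [h4] at h3
      refine h3.congr_of_eventuallyEq (Eventually.of_forall fun s => ?_)
      simp [hsq]
    have h5 : HasDerivAt (fun s => Real.exp (-K * s)) (Real.exp (-K * t) * (-K)) t := by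
      simpa using ((hasDerivAt_id t).const_mul (-K)).exp
    have h6 := (h5.mul h2).sub ((hasDerivAt_id t).const_mul b)
    convert! h6 using 1
    ring
  have hanti : AntitoneOn (fun s => Real.exp (-K * s) * ‖z s‖ ^ 2 - b * s) (Icc 0 T) := by
    refine antitoneOn_of_deriv_nonpos (convex_Icc 0 T) (by fun_prop) ?_ ?_
    · rw [interior_Icc]
      exact fun t ht => (hder t ht).differentiableAt.differentiableWithinAt
    · rw [interior_Icc]
      intro t ht
      rw [(hder t ht).deriv]
      have h1 := h t ht
      have h2 : Real.exp (-K * t) ≤ 1 := Real.exp_le_one_iff.2 (by nlinarith [ht.1])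
      nlinarith [Real.exp_pos (-K * t)]
  have h1 := hanti ⟨le_rfl, ht.1.trans ht.2⟩ ht ht.1
  simp only [mul_zero, Real.exp_zero, one_mul, sub_zero] at h1
  have h2 : Real.exp (-K * t) * ‖z t‖ ^ 2 ≤ ‖z 0‖ ^ 2 + T * b := by nlinarith [ht.2]
  calc ‖z t‖ ^ 2 = Real.exp (K * t) * (Real.exp (-K * t) * ‖z t‖ ^ 2) := by
        rw [← mul_assoc, ← Real.exp_add]; simp
    _ ≤ Real.exp (K * t) * (‖z 0‖ ^ 2 + T * b) := by gcongr
    _ ≤ _ := by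
        have : 0 ≤ ‖z 0‖ ^ 2 + T * b := le_trans (by positivity) h2
        have := ht.2
        gcongr

/-! ### Mollifiers with vanishing moments -/

theorem integrable_schwartz_mul_of_bound {d n : ℕ} (ψ : 𝓢(Space d, ℝ)) {f : Space d → ℝ}
    (hf : Continuous f) {C : ℝ} (hC : ∀ y, |f y| ≤ C * ‖y‖ ^ n) :
    Integrable (fun y => ψ y * f y) := by
  refine ((ψ.integrable_pow_mul volume n).const_mul C).mono'
    (ψ.continuous.mul hf).aestronglyMeasurable (Eventually.of_forall fun y => ?_)
  rw [norm_mul, Real.norm_eq_abs (f y)]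
  nlinarith [hC y, norm_nonneg (ψ y)]

theorem integrable_schwartz_mul_multilinear {d n : ℕ} (ψ : 𝓢(Space d, ℝ))
    (A : ContinuousMultilinearMap ℝ (fun _ : Fin n => Space d) ℝ) :
    Integrable (fun y => ψ y * A fun _ => y) := by
  refine integrable_schwartz_mul_of_bound (n := n) (C := ‖A‖) ψ (by fun_prop) fun y => ?_
  simpa using A.le_opNorm fun _ => y

/-- Expanding `y` in the standard basis turns the form into a combination of monomials of degree
`n`; the exponent of `y i` counts the slots carrying the index `i`. -/
theorem integral_mul_multilinear_eq_zero {d n : ℕ} {ψ : 𝓢(Space d, ℝ)}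
    (hψ : ψ ∈ mollifierClassInf d) (hn : n ≠ 0)
    (A : ContinuousMultilinearMap ℝ (fun _ : Fin n => Space d) ℝ) :
    ∫ y, ψ y * A (fun _ => y) = 0 := by
  have hexp : ∀ y : Space d, ψ y * A (fun _ => y) = ∑ r : Fin n → Fin d,
      ψ y * ((∏ l, y (r l)) * A fun l => EuclideanSpace.single (r l) 1) := by
    intro y
    have h1 : (fun _ : Fin n => y)
        = fun _ => ∑ i, y i • (EuclideanSpace.single i (1 : ℝ) : Space d) := by
      funext _
      simpa using ((EuclideanSpace.basisFun (Fin d) ℝ).sum_repr y).symm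
    rw [← Finset.mul_sum]
    congr 1
    conv_lhs => rw [h1]
    rw [ContinuousMultilinearMap.map_sum]
    refine Finset.sum_congr rfl fun r _ => ?_
    rw [ContinuousMultilinearMap.map_smul_univ, smul_eq_mul]
  simp_rw [hexp]
  rw [integral_finsetSum]
  · refine Finset.sum_eq_zero fun r _ => ?_
    have h2 : ∀ y : Space d, ∏ l, y (r l) = ∏ i, y i ^ (Finset.univ.filter (r · = i)).card := by
      intro y
      rw [← Finset.prod_fiberwise' Finset.univ r (fun i => y i)]
      simp
    have h3 : ∑ i, (Finset.univ.filter (r · = i)).card = n := by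
      have := Finset.card_eq_sum_card_fiberwise (f := r) (s := Finset.univ) (t := Finset.univ)
        (by simp)
      simpa using this.symm
    have h4 := (hψ n).2 (fun i => (Finset.univ.filter (r · = i)).card) (by omega) (by omega)
    simp_rw [← h2] at h4
    calc _ = ∫ y : Space d, ((∏ l, y (r l)) * ψ y) * A fun l => EuclideanSpace.single (r l) 1 := by
          congr 1; ext y; ring
      _ = 0 := by rw [integral_mul_const, h4, zero_mul]
  · intro r _
    refine integrable_schwartz_mul_of_bound (n := n)
      (C := |A fun l => EuclideanSpace.single (r l) 1|) ψ (by fun_prop) fun y => ?_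
    rw [abs_mul, mul_comm, Finset.abs_prod]
    gcongr
    calc ∏ l, |y (r l)| ≤ ∏ _l : Fin n, ‖y‖ :=
          Finset.prod_le_prod (fun _ _ => abs_nonneg _) fun l _ => PiLp.norm_apply_le y (r l)
      _ = _ := by simp

theorem regularise_eq_integral {d : ℕ} (ψ : 𝓢(Space d, ℝ)) {δ : ℝ} (hδ : 0 < δ)
    (q : Space d → ℝ) (x : Space d) :
    regularise ψ δ q x = ∫ y, ψ y * q (x + -(δ • y)) := by
  have h := Measure.integral_comp_inv_smul_of_nonneg (volume : Measure (Space d))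
    (fun y => ψ y * q (x + -(δ • y))) hδ.le
  simp only [smul_inv_smul₀ hδ.ne', finrank_euclideanSpace, Fintype.card_fin] at h
  rw [regularise, convolution_lsmul]
  simp only [rescale, smul_eq_mul, mul_assoc, sub_eq_add_neg]
  rw [integral_const_mul, h, smul_eq_mul, inv_mul_cancel_left₀ (by positivity)]

theorem abs_sub_taylor_le {E : Type*} [NormedAddCommGroup E] [NormedSpace ℝ E] {q : E → ℝ}
    (hq : ContDiff ℝ (⊤ : ℕ∞) q) {n : ℕ} {C : ℝ}
    (hC : ∀ x, ‖iteratedFDeriv ℝ (n + 1) q x‖ ≤ C) (x y : E) :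
    |q (x + y) - ∑ k ∈ Finset.range (n + 1),
      (k.factorial : ℝ)⁻¹ • iteratedFDeriv ℝ k q x fun _ => y| ≤ C * ‖y‖ ^ (n + 1) := by
  have h := map_add_eq_sum_add_integral_iteratedFDeriv (f := q) (x := x) (y := y) (n := n)
    fun t _ => hq.contDiffAt.of_le (by exact_mod_cast le_top)
  rw [h, add_sub_cancel_left, smul_eq_mul, abs_mul]
  have hC0 : 0 ≤ C := (norm_nonneg _).trans (hC x)
  have h1 : |(n.factorial : ℝ)⁻¹| ≤ 1 := by
    rw [abs_of_nonneg (by positivity)]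
    exact inv_le_one_of_one_le₀ (by exact_mod_cast n.factorial_pos)
  have h2 : ‖∫ t in (0 : ℝ)..1, (1 - t) ^ n • iteratedFDeriv ℝ (n + 1) q (x + t • y) fun _ => y‖
      ≤ C * ‖y‖ ^ (n + 1) * |1 - 0| := by
    refine intervalIntegral.norm_integral_le_of_norm_le_const fun t ht => ?_
    rw [uIoc_of_le zero_le_one] at ht
    rw [norm_smul, norm_pow]
    have h3 : ‖1 - t‖ ^ n ≤ 1 := by
      refine pow_le_one₀ (norm_nonneg _) ?_
      rw [Real.norm_eq_abs, abs_le]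
      constructor <;> linarith [ht.1, ht.2]
    have h4 : ‖iteratedFDeriv ℝ (n + 1) q (x + t • y) fun _ => y‖ ≤ C * ‖y‖ ^ (n + 1) := by
      refine ((iteratedFDeriv ℝ (n + 1) q (x + t • y)).le_opNorm _).trans ?_
      simp only [Finset.prod_const, Finset.card_univ, Fintype.card_fin]
      gcongr
      exact hC _
    calc _ ≤ 1 * (C * ‖y‖ ^ (n + 1)) := by gcongr
      _ = _ := one_mul _
  simp only [sub_zero, abs_one, mul_one, Real.norm_eq_abs] at h2
  calc _ ≤ 1 * (C * ‖y‖ ^ (n + 1)) := by gcongr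
    _ = _ := one_mul _

/-- Mollification by `ψ ∈ 𝔸_∞` approximates a function with bounded derivatives to all orders. -/
theorem exists_abs_regularise_sub_le {d : ℕ} {ψ : 𝓢(Space d, ℝ)} (hψ : ψ ∈ mollifierClassInf d)
    {q : Space d → ℝ} (hq : ContDiff ℝ (⊤ : ℕ∞) q)
    (hb : ∀ k : ℕ, ∃ C : ℝ, ∀ x, ‖iteratedFDeriv ℝ k q x‖ ≤ C) (n : ℕ) :
    ∃ C, ∀ δ, 0 < δ → ∀ x, |regularise ψ δ q x - q x| ≤ C * δ ^ (n + 1) := by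
  obtain ⟨C, hC⟩ := hb (n + 1)
  obtain ⟨C₀, hC₀⟩ := hb 0
  refine ⟨∫ y, C * (‖y‖ ^ (n + 1) * ‖ψ y‖), fun δ hδ x => ?_⟩
  have hpow : ∀ (k : ℕ) (y : Space d), (iteratedFDeriv ℝ k q x fun _ => -(δ • y))
      = (-δ) ^ k * iteratedFDeriv ℝ k q x fun _ => y := by
    intro k y
    have := (iteratedFDeriv ℝ k q x).map_smul_univ (fun _ => -δ) (fun _ => y)
    simpa using this
  -- The Taylor polynomial of `q` at `x`, in the increment `-(δ • y)`. Integrated against `ψ`, only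
  -- its constant term `q x` survives, so the error is the averaged Taylor remainder.
  set P : Space d → ℝ := fun y => ∑ k ∈ Finset.range (n + 1),
    (k.factorial : ℝ)⁻¹ • iteratedFDeriv ℝ k q x fun _ => -(δ • y) with hP
  have hPe : (fun y => ψ y * P y) = fun y => ∑ k ∈ Finset.range (n + 1),
      ((k.factorial : ℝ)⁻¹ * (-δ) ^ k) * (ψ y * iteratedFDeriv ℝ k q x fun _ => y) := by
    funext y
    simp only [hP, hpow, smul_eq_mul, Finset.mul_sum]
    exact Finset.sum_congr rfl fun k _ => by ring
  have hPi : Integrable (fun y => ψ y * P y) := by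
    rw [hPe]
    exact integrable_finsetSum _ fun k _ =>
      (integrable_schwartz_mul_multilinear ψ _).const_mul _
  have hP1 : ∫ y, ψ y * P y = q x := by
    rw [hPe, integral_finsetSum _ fun k _ =>
      (integrable_schwartz_mul_multilinear ψ _).const_mul _, Finset.sum_range_succ']
    simp_rw [integral_const_mul]
    rw [Finset.sum_eq_zero fun k _ => by
      rw [integral_mul_multilinear_eq_zero hψ k.succ_ne_zero, mul_zero]]
    simp [integral_mul_const, (hψ 0).1]
  have hqi : Integrable (fun y => ψ y * q (x + -(δ • y))) := by
    refine integrable_schwartz_mul_of_bound (n := 0) (C := C₀) ψ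
      (hq.continuous.comp (by fun_prop)) fun y => ?_
    simpa using hC₀ (x + -(δ • y))
  rw [regularise_eq_integral ψ hδ, ← hP1, ← integral_sub hqi hPi, ← integral_mul_const,
    ← Real.norm_eq_abs]
  refine norm_integral_le_of_norm_le
    (((ψ.integrable_pow_mul volume (n + 1)).const_mul C).mul_const _)
    (Eventually.of_forall fun y => ?_)
  rw [← mul_sub, norm_mul]
  have h := abs_sub_taylor_le hq hC x (-(δ • y))
  rw [norm_neg, norm_smul, Real.norm_of_nonneg hδ.le, mul_pow] at h
  rw [Real.norm_eq_abs (_ - _)]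
  calc _ ≤ ‖ψ y‖ * (C * (δ ^ (n + 1) * ‖y‖ ^ (n + 1))) := by gcongr
    _ = _ := by ring

/-- The L¹ norm of the rescaled mollifier does not depend on `δ`, so `M` can be `C₀` times that
norm. -/
theorem exists_neg_le_regularise {d : ℕ} (ψ : 𝓢(Space d, ℝ)) {q : Space d → ℝ} {C₀ : ℝ}
    (hC₀ : ∀ x, |q x| ≤ C₀) :
    ∃ M, 0 ≤ M ∧ ∀ δ, 0 < δ → ∀ x, -M ≤ regularise ψ δ q x := by
  have hC0 : 0 ≤ C₀ := (abs_nonneg _).trans (hC₀ 0)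
  refine ⟨∫ y, ‖ψ y‖ * C₀, integral_nonneg fun y => by positivity, fun δ hδ x => ?_⟩
  refine (abs_le.1 ?_).1
  rw [regularise_eq_integral ψ hδ, ← Real.norm_eq_abs]
  refine norm_integral_le_of_norm_le (ψ.integrable.norm.mul_const _)
    (Eventually.of_forall fun y => ?_)
  rw [norm_mul]
  gcongr
  exact hC₀ _

theorem coeffNegligible_of_bounded_derivatives {d : ℕ} {ω : ℝ → ℝ}
    (hω : ∀ ε ∈ Ioc (0 : ℝ) 1, 0 < ω ε) {q : Space d → ℝ} (hq : ContDiff ℝ (⊤ : ℕ∞) q)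
    (hb : ∀ k : ℕ, ∃ C : ℝ, ∀ x, ‖iteratedFDeriv ℝ k q x‖ ≤ C) {ψ ψ' : 𝓢(Space d, ℝ)}
    (hψ : ψ ∈ mollifierClassInf d) (hψ' : ψ' ∈ mollifierClassInf d) :
    CoeffNegligible ω q ψ ψ' := by
  intro k hk
  obtain ⟨n, rfl⟩ := Nat.exists_eq_succ_of_ne_zero hk.ne'
  obtain ⟨C, hC⟩ := exists_abs_regularise_sub_le hψ hq hb n
  obtain ⟨C', hC'⟩ := exists_abs_regularise_sub_le hψ' hq hb n
  -- The absolute value and the `1` only make the constant strictly positive.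
  refine ⟨|C + C'| + 1, by positivity, fun ε hε => ?_⟩
  have hp := hω ε hε
  rw [eLpNorm_exponent_top]
  refine eLpNormEssSup_le_of_ae_bound (Eventually.of_forall fun x => ?_)
  have h1 := hC _ hp x
  have h2 := hC' _ hp x
  rw [Pi.sub_apply, Real.norm_eq_abs]
  calc _ = |(regularise ψ (ω ε) q x - q x) - (regularise ψ' (ω ε) q x - q x)| := by ring_nf
    _ ≤ C * ω ε ^ (n + 1) + C' * ω ε ^ (n + 1) := (abs_sub _ _).trans (add_le_add h1 h2)
    _ = (C + C') * ω ε ^ (n + 1) := by ring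
    _ ≤ (|C + C'| + 1) * ω ε ^ (n + 1) :=
      mul_le_mul_of_nonneg_right (by linarith [le_abs_self (C + C')]) (by positivity)

/-! ### Comparison of two solutions -/

theorem laplacian_sub_L2 {d : ℕ} {z z' w w' : L2 d}
    (h : Δ (z : 𝓢'(Space d, ℂ)) = (w : 𝓢'(Space d, ℂ)))
    (h' : Δ (z' : 𝓢'(Space d, ℂ)) = (w' : 𝓢'(Space d, ℂ))) :
    Δ ((z - z' : L2 d) : 𝓢'(Space d, ℂ)) = ((w - w' : L2 d) : 𝓢'(Space d, ℂ)) := by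
  simp only [← Lp.toTemperedDistributionCLM_apply, ← TemperedDistribution.laplacianCLM_apply,
    map_sub] at h h' ⊢
  rw [h, h']

theorem SolvesHeat.differentiableAt {d : ℕ} {T : ℝ} {p : Space d → ℝ} {f : Space d → ℂ}
    {u : ℝ → H1 d} (hu : SolvesHeat T p f u) {t : ℝ} (ht : t ∈ Ioo 0 T) :
    DifferentiableAt ℝ (fun s => toL2 (u s)) t :=
  (hu.contDiffOn.differentiableOn one_ne_zero).differentiableAt (Icc_mem_nhds ht.1 ht.2)

theorem SolvesHeat.norm_sq_le {d : ℕ} {T : ℝ} {p : Space d → ℝ} {f : Space d → ℂ}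
    {u : ℝ → H1 d} (hu : SolvesHeat T p f u) {M : ℝ} (hM : 0 ≤ M) (hp : ∀ x, -M ≤ p x)
    {t : ℝ} (ht : t ∈ Icc 0 T) :
    ‖toL2 (u t)‖ ^ 2 ≤ Real.exp ((2 * M + 1) * T) * ‖toL2 (u 0)‖ ^ 2 := by
  have h := norm_sq_le_of_energy (z := fun s => toL2 (u s)) (K := 2 * M + 1) (b := 0)
    (by positivity) le_rfl hu.contDiffOn.continuousOn (fun _ => hu.differentiableAt)
    (fun s hs => ?_) ht
  · simpa using h
  · obtain ⟨w, hw, heq⟩ := hu.equation s hs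
    have := two_mul_re_inner_le (v := (0 : L2 d)) (η := 0) hw hp (g := fun _ => 0) (by simp) heq
    simpa using this

theorem SolvesHeat.norm_sub_sq_le {d : ℕ} {T : ℝ} {p p' : Space d → ℝ} {f f' : Space d → ℂ}
    {u u' : ℝ → H1 d} (hu : SolvesHeat T p f u) (hu' : SolvesHeat T p' f' u') {M η B : ℝ}
    (hM : 0 ≤ M) (hp : ∀ x, -M ≤ p x) (hpp : ∀ᵐ x, ‖p x - p' x‖ ≤ η) (hB : 0 ≤ B)
    (hu'B : ∀ t ∈ Icc 0 T, ‖toL2 (u' t)‖ ^ 2 ≤ B) {t : ℝ} (ht : t ∈ Icc 0 T) :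
    ‖toL2 (u t) - toL2 (u' t)‖ ^ 2
      ≤ Real.exp ((2 * M + 1) * T) * (‖toL2 (u 0) - toL2 (u' 0)‖ ^ 2 + T * (η ^ 2 * B)) := by
  refine norm_sq_le_of_energy (z := fun s => toL2 (u s) - toL2 (u' s)) (by positivity)
    (by positivity) (hu.contDiffOn.continuousOn.sub hu'.contDiffOn.continuousOn)
    (fun s hs => (hu.differentiableAt hs).sub (hu'.differentiableAt hs)) (fun s hs => ?_) ht
  obtain ⟨w, hw, heq⟩ := hu.equation s hs
  obtain ⟨w', hw', heq'⟩ := hu'.equation s hs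
  rw [deriv_fun_sub (hu.differentiableAt hs) (hu'.differentiableAt hs)]
  -- The splitting `p u - p' u' = p (u - u') + (p - p') u'` leaves a source involving only `u'`.
  refine (two_mul_re_inner_le (v := toL2 (u' s)) (η := η) (laplacian_sub_L2 hw hw') hp
    (g := fun x => -(((p x - p' x : ℝ) : ℂ) * toL2 (u' s) x)) ?_ ?_).trans ?_
  · filter_upwards [hpp] with x hx
    rw [norm_neg, norm_mul, Complex.norm_real]
    gcongr
  · filter_upwards [heq, heq', Lp.coeFn_sub (deriv (fun s => toL2 (u s)) s)
      (deriv (fun s => toL2 (u' s)) s), Lp.coeFn_sub w w',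
      Lp.coeFn_sub (toL2 (u s)) (toL2 (u' s))] with x h1 h2 h3 h4 h5
    rw [h3, h4, h5]
    simp only [Pi.sub_apply]
    push_cast
    linear_combination h1 - h2
  · gcongr
    exact hu'B s ⟨hs.1.le, hs.2.le⟩

theorem norm_toL2_le {d : ℕ} (v : H1 d) : ‖toL2 v‖ ≤ ‖v‖ :=
  WithLp.norm_fst_le _ (v : WithLp 2 (L2 d × PiLp 2 (fun _ : Fin d => L2 d)))

theorem netsAgree_of_coeffNegligible {d : ℕ} {T : ℝ} (hT : 0 < T) {ω : ℝ → ℝ}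
    (hω : ∀ ε ∈ Ioc (0 : ℝ) 1, 0 < ω ε) {q : Space d → ℝ} {u₀ : H1 d} {ψ ψ' : 𝓢(Space d, ℝ)}
    {M : ℝ} (hM : 0 ≤ M) (hp : ∀ ε ∈ Ioc (0 : ℝ) 1, ∀ x, -M ≤ regularise ψ (ω ε) q x)
    (hp' : ∀ ε ∈ Ioc (0 : ℝ) 1, ∀ x, -M ≤ regularise ψ' (ω ε) q x)
    (hmod : DataModerate ω u₀ ψ') (hdata : DataNegligible ω u₀ ψ ψ')
    (hcoeff : CoeffNegligible ω q ψ ψ') {u u' : ℝ → ℝ → H1 d}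
    (hu : SolvesRegularised T ω q u₀ ψ u) (hu' : SolvesRegularised T ω q u₀ ψ' u') :
    NetsAgree T ω u u' := by
  intro N hN
  obtain ⟨N₀, C₀, hC₀, hmod⟩ := hmod
  obtain ⟨C₁, hC₁, hdata⟩ := hdata N hN
  -- The extra `N₀` orders cancel the growth `ω ε ^ (-N₀)` of `u'`.
  obtain ⟨C₂, hC₂, hcoeff⟩ := hcoeff (N + N₀) (by omega)
  set e := Real.exp ((2 * M + 1) * T) with he
  have he0 : 0 < e := Real.exp_pos _
  have hpos : 0 < e * (C₁ ^ 2 + T * (C₂ ^ 2 * (e * C₀ ^ 2))) := by positivity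
  refine ⟨√(e * (C₁ ^ 2 + T * (C₂ ^ 2 * (e * C₀ ^ 2)))), Real.sqrt_pos.2 hpos,
    fun ε hε t ht => ?_⟩
  have hωε := hω ε hε
  have hinit' : ‖toL2 (u' ε 0)‖ ≤ C₀ * (ω ε ^ N₀)⁻¹ := by
    obtain ⟨v, hv, hvC⟩ := hmod ε hε
    rw [show toL2 (u' ε 0) = toL2 v from Lp.ext ((hu' ε hε).initial.trans hv.symm)]
    exact (norm_toL2_le v).trans hvC
  have hinit : ‖toL2 (u ε 0) - toL2 (u' ε 0)‖ ≤ C₁ * ω ε ^ N := by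
    rw [Lp.norm_def]
    refine ENNReal.toReal_le_of_le_ofReal (by positivity) ?_
    refine (eLpNorm_congr_ae ?_).trans_le (hdata ε hε)
    exact (Lp.coeFn_sub _ _).trans ((hu ε hε).initial.sub (hu' ε hε).initial)
  have hpp : ∀ᵐ x, ‖regularise ψ (ω ε) q x - regularise ψ' (ω ε) q x‖
      ≤ C₂ * ω ε ^ (N + N₀) := by
    have h := hcoeff ε hε
    rw [eLpNorm_exponent_top] at h
    filter_upwards [enorm_ae_le_eLpNormEssSup
      (regularise ψ (ω ε) q - regularise ψ' (ω ε) q) volume] with x hx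
    have h2 := hx.trans h
    rwa [← ofReal_norm, ENNReal.ofReal_le_ofReal_iff (by positivity)] at h2
  have h := (hu ε hε).norm_sub_sq_le (hu' ε hε) hM (hp ε hε) hpp
    (B := e * (C₀ * (ω ε ^ N₀)⁻¹) ^ 2) (by positivity)
    (fun s hs => ((hu' ε hε).norm_sq_le hM (hp' ε hε) hs).trans (by gcongr)) ht
  refine abs_le_of_sq_le_sq' ?_ (by positivity) |>.2
  rw [mul_pow, Real.sq_sqrt hpos.le]
  refine h.trans ?_
  calc e * (‖toL2 (u ε 0) - toL2 (u' ε 0)‖ ^ 2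
        + T * ((C₂ * ω ε ^ (N + N₀)) ^ 2 * (e * (C₀ * (ω ε ^ N₀)⁻¹) ^ 2)))
      ≤ e * ((C₁ * ω ε ^ N) ^ 2
        + T * ((C₂ * ω ε ^ (N + N₀)) ^ 2 * (e * (C₀ * (ω ε ^ N₀)⁻¹) ^ 2))) := by gcongr
    _ = _ := by
      rw [pow_add]
      field_simp

theorem mainTheorem2 (d : ℕ) (T : ℝ) (hT : 0 < T) (ω : ℝ → ℝ)
    (hω : ∀ ε ∈ Ioc (0 : ℝ) 1, 0 < ω ε) (hω0 : Tendsto ω (𝓝[>] 0) (𝓝 0))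
    (q : Space d → ℝ) (hq : ContDiff ℝ (⊤ : ℕ∞) q) (hq0 : ∀ x, 0 ≤ q x) (u₀ : H1 d) :
    VeryWeakSolutionUnique T ω q u₀ ∧
      ((∀ k : ℕ, ∃ C : ℝ, ∀ x, ‖iteratedFDeriv ℝ k q x‖ ≤ C) →
        VeryWeakSolutionUniqueOfData T ω q u₀) := by
  refine ⟨?_, fun hb => ?_⟩
  · intro ψ _ ψ' _ _ hmod _ _ hnn hnn' hdata hcoeff u u' hu hu'
    exact netsAgree_of_coeffNegligible hT hω le_rfl 
      (fun ε hε x => by simpa using hnn ε hε x) (fun ε hε x => by simpa using hnn' ε hε x)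
      hmod hdata hcoeff hu hu'
  · intro ψ hψ ψ' hψ' _ hmod hdata u u' hu hu'
    obtain ⟨C₀, hC₀⟩ := hb 0
    have hC₀' : ∀ x, |q x| ≤ C₀ := by simpa using hC₀
    obtain ⟨M, hM, hp⟩ := exists_neg_le_regularise ψ hC₀'
    obtain ⟨M', _, hp'⟩ := exists_neg_le_regularise ψ' hC₀'
    exact netsAgree_of_coeffNegligible hT hω (M := max M M') (hM.trans (le_max_left _ _))
      (fun ε hε x => (neg_le_neg (le_max_left _ _)).trans (hp _ (hω ε hε) x))
      (fun ε hε x => (neg_le_neg (le_max_right _ _)).trans (hp' _ (hω ε hε) x))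
      hmod hdata (coeffNegligible_of_bounded_derivatives hω hq hb hψ hψ') hu hu'
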